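/- **Theorem 1.** Let $d,n$ be positive integers with $n \mid d$. For an ordered partition $\mathcal B=(B_1,\dots,B_n)$ of $[d]$ into blocks of equal size $d/n$ put $\|x\|_{\mathcal B}=\sum_{j=1}^n\|x_{B_j}\|_2$ and $$h_{\mathcal B}(x)=\frac1{\gamma_n p_n}\sum_{j=1}^n\|x_{B_j}\|_2^{p_n},\qquad \gamma_n=\begin{cases}1&n=1\\ \tfrac12&n=2\\ \tfrac1{e\ln n}&n>2\end{cases},\qquad p_n=\begin{cases}2&n\le2\\ 1+\tfrac1{\ln n}&n>2\end{cases},$$ and let $B_h(x\|y)=h(x)-h(y)-\langle\nabla h(y),x-y\rangle$. Let $\mathcal B$ be chosen uniformly at random among all such partitions, once and for all before the first round; $\mathbb E$ denotes expectation over $\mathcal B$. Let $\mathcal K\subseteq\mathbb R^d$ be a compact convex set with $\|x\|_{\mathcal B}\le1$ for all $x\in\mathcal K$ and all such partitions $\mathcal B$, let $x^{(1)}\in\mathcal K$, let $S\ge1$ and $T\ge 0$ be integers, and let $$D_n=\Big(\mathbb E\Big[\max_{z\in\mathcal K}B_{h_{\mathcal B}}(z\,\|\,x^{(1)})\Big]\Big)^{1/2}$$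 be the (root mean square) diameter; if $\max_{z\in\mathcal K}B_{h_{\mathcal B}}(z\|x^{(1)})$ does not depend on $\mathcal B$, this is just its square root, and it is always at most $\max_{\mathcal B}\sqrt{\max_{z\in\mathcal K}B_{h_{\mathcal B}}(z\|x^{(1)})}$. Then there is a constant step size $\eta>0$, which depends neither on $\mathcal B$ nor on the losses, such that the following holds for every sequence $f^{(1)},\dots,f^{(T)}$ of convex loss functions on $\mathcal K$, fixed independently of $\mathcal B$, that are $S$-sparse, i.e. differentiable on $\mathcal K$ with $\nabla f^{(t)}(x)\in\{0,1\}^d$ and $\|\nabla f^{(t)}(x)\|_1\le S$ for all $x\in\mathcal K$. Online mirror descent, $$x^{(t+1)}=\operatorname*{arg\,min}_{x\in\mathcal K}\ \big\langle\nabla f^{(t)}(x^{(t)}),x\big\rangle+\tfrac1\eta B_{h_{\mathcal B}}(x\,\|\,x^{(t)}),$$ has regret $\mathrm{regret}_n(T)=\sum_{t=1}^Tf^{(t)}(x^{(t)})-\min_{x\in\mathcal K}\sum_{t=1}^Tf^{(t)}(x)$ satisfying $$\mathbb E[\mathrm{regret}_n(T)]\le\begin{cases}C\,\sqrt{S/n}\;D_n\sqrt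 T&\text{if } n\le S/\ln S \text{ or } n=1,\\ C\,\sqrt{\ln n}\;D_n\sqrt T&\text{otherwise,}\end{cases}$$ where $C>0$ is an absolute constant. (For $S\ge2$ the clause "or $n=1$" is redundant; for $S=1$, where $S/\ln S$ is undefined, the first case is understood to be $n=1$ only.) -/

import Mathlib

noncomputable section

namespace BlockOMD

/-- The space `ℝ^d` with its standard inner product. -/
abbrev Vec (d : ℕ) : Type := EuclideanSpace ℝ (Fin d)

/-- The ordered partitions `(B_1, …, B_n)` of the `d` coordinates into `n` blocks of equal size
`d / n`, encoded by the map `b` that sends a coordinate to the index of its block. -/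
def equalPartitions (d n : ℕ) : Finset (Fin d → Fin n) :=
  Finset.univ.filter fun b => ∀ j : Fin n, (Finset.univ.filter fun i => b i = j).card * n = d

/-- Expectation of `X` under the uniform distribution on equal-size partitions. -/
def expectation {d n : ℕ} (X : (Fin d → Fin n) → ℝ) : ℝ :=
  (∑ b ∈ equalPartitions d n, X b) / ((equalPartitions d n).card : ℝ)

/-- `‖x_{B_j}‖₂`, the Euclidean norm of the `j`-th block of `x`. -/
def blockEuclid {d n : ℕ} (b : Fin d → Fin n) (x : Vec d) (j : Fin n) : ℝ :=
  Real.sqrt (∑ i ∈ Finset.univ.filter (fun i => b i = j), x i ^ 2)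

/-- The block norm: the sum of the Euclidean norms of the blocks. -/
def blockNorm {d n : ℕ} (b : Fin d → Fin n) (x : Vec d) : ℝ :=
  ∑ j : Fin n, blockEuclid b x j

/-- The normalization `γ_n`. -/
def gammaCoeff (n : ℕ) : ℝ :=
  if n = 1 then 1 else if n = 2 then 1 / 2 else 1 / (Real.exp 1 * Real.log n)

/-- The exponent `p_n`. -/
def pExp (n : ℕ) : ℝ :=
  if n ≤ 2 then 2 else 1 + 1 / Real.log n

/-- The mirror map `h_n(x) = (1 / (γ_n p_n)) ∑_j ‖x_{B_j}‖₂ ^ p_n`. -/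
def mirrorMap {d n : ℕ} (b : Fin d → Fin n) (x : Vec d) : ℝ :=
  1 / (gammaCoeff n * pExp n) * ∑ j : Fin n, blockEuclid b x j ^ pExp n

/-- The Bregman divergence `B_h(x ‖ y)`. -/
def bregman {d : ℕ} (h : Vec d → ℝ) (x y : Vec d) : ℝ :=
  h x - h y - inner ℝ (gradient h y) (x - y)

/-- The squared Bregman diameter `max_{z ∈ K} B_h(z ‖ x₁)`. -/
def diamSq {d : ℕ} (h : Vec d → ℝ) (K : Set (Vec d)) (x₁ : Vec d) : ℝ :=
  sSup ((fun z => bregman h z x₁) '' K)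

/-- `f` is an `S`-sparse convex loss on `K` with gradient `g`: at every point of `K` the gradient
is a `0`-`1` vector with at most `S` ones. Only the values of `f` and `g` on `K` matter. -/
structure IsSparseLoss {d : ℕ} (S : ℕ) (K : Set (Vec d)) (f : Vec d → ℝ) (g : Vec d → Vec d) :
    Prop where
  convexOn : ConvexOn ℝ K f
  hasGradient : ∀ x ∈ K, HasGradientWithinAt f (g x) K x
  zero_one : ∀ x ∈ K, ∀ i, g x i = 0 ∨ g x i = 1
  sparse : ∀ x ∈ K, ∑ i, |g x i| ≤ (S : ℝ)

/-- `x 0, …, x (T - 1)` are the points played by online mirror descent over `T` rounds, with mirror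
map `h`, constant step size `η` and starting point `x₁`, when `g t` is the gradient of the loss of
round `t` (rounds are numbered from `0`). -/
structure IsOMDRun {d : ℕ} (h : Vec d → ℝ) (K : Set (Vec d)) (η : ℝ) (x₁ : Vec d) (T : ℕ)
    (g : ℕ → Vec d → Vec d) (x : ℕ → Vec d) : Prop where
  start : x 0 = x₁
  mem : ∀ t, t + 1 < T → x (t + 1) ∈ K
  argmin : ∀ t, t + 1 < T →
    IsMinOn (fun z => inner ℝ (g t (x t)) z + 1 / η * bregman h z (x t)) K (x (t + 1))

/-- Regret over `T` rounds of the played points `x` against the best fixed point of `K`. -/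
def regret {d : ℕ} (K : Set (Vec d)) (T : ℕ) (f : ℕ → Vec d → ℝ) (x : ℕ → Vec d) : ℝ :=
  ∑ t ∈ Finset.range T, f t (x t) - sInf ((fun z => ∑ t ∈ Finset.range T, f t z) '' K)

end BlockOMD

end

/-! For a fixed partition, mirror descent has regret at most `D²/η + η ∑ₜ Mₜ`, where `D²` is the
squared Bregman diameter and `Mₜ` is the largest number of ones of the round-`t` gradient in one
block. This combines two facts. On the unit ball of the block norm the Bregman divergence is at
least a quarter of the squared block norm (`blockNorm_sq_le_bregman`); the values of `p_n` and `γ_n`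
are what make this constant independent of `n`. Dually, a `0`-`1` vector has dual block norm at most
the square root of its maximal load (`inner_le_sqrt_maxLoad_mul`).

It remains to average over the partition. The iterates depend on it, so a priori the gradients do
too. But a differentiable function on a convex set with finitely many gradients is affine there, by
the Darboux property (`sub_eq_inner_of_finite_gradients`), so each gradient may be replaced by the
one at `x₁`, whose support is fixed in advance. For a fixed set of at most `S` coordinates, an
exponential moment bound gives expected maximal load at most `L = (log n + S/n) / log 2`
(`expectation_maxLoad_le`). Balancing `η` gives `2 D √(L T)`, and `L` is of order `S/n` or `log n`
in the two regimes. -/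

noncomputable section

namespace BlockOMD

/-! ### Maximal load of a fixed set under a random equal-size partition -/

/-- The equal-size partitions whose `j`-th block contains `A`. -/
def partitionsContaining {d n : ℕ} (j : Fin n) (A : Finset (Fin d)) : Finset (Fin d → Fin n) :=
  (equalPartitions d n).filter fun b => ∀ i ∈ A, b i = j

theorem card_fiber_mul {d n : ℕ} {b : Fin d → Fin n} (hb : b ∈ equalPartitions d n) (j : Fin n) :
    (Finset.univ.filter fun i => b i = j).card * n = d :=
  (Finset.mem_filter.1 hb).2 j

theorem comp_perm_mem_equalPartitions {d n : ℕ} {b : Fin d → Fin n}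
    (hb : b ∈ equalPartitions d n) (σ : Equiv.Perm (Fin d)) : b ∘ σ ∈ equalPartitions d n := by
  refine Finset.mem_filter.2 ⟨Finset.mem_univ _, fun j => ?_⟩
  refine Eq.trans ?_ (card_fiber_mul hb j)
  congr 1
  exact Finset.card_equiv σ (by simp)

/-- Exchangeability: relabelling by the transposition of `a` and `a'` is injective. -/
theorem card_partitionsContaining_insert_le {d n : ℕ} (j : Fin n) {A : Finset (Fin d)}
    {a a' : Fin d} (ha : a ∉ A) (ha' : a' ∉ A) :
    (partitionsContaining j (insert a A)).card ≤ (partitionsContaining j (insert a' A)).card := by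
  refine Finset.card_le_card_of_injOn (fun b => b ∘ Equiv.swap a a') ?_ ?_
  · intro b hb
    have hb := Finset.mem_filter.1 hb
    refine Finset.mem_filter.2 ⟨comp_perm_mem_equalPartitions hb.1 _, fun i hi => ?_⟩
    rcases Finset.mem_insert.1 hi with rfl | hi
    · simpa using hb.2 a (Finset.mem_insert_self _ _)
    · have h1 : i ≠ a := fun h => ha (h ▸ hi)
      have h2 : i ≠ a' := fun h => ha' (h ▸ hi)
      simpa [Equiv.swap_apply_of_ne_of_ne h1 h2] using hb.2 i (Finset.mem_insert_of_mem hi)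
  · exact (Equiv.swap a a').surjective.injective_comp_right.injOn

theorem partitionsContaining_insert {d n : ℕ} (j : Fin n) (A : Finset (Fin d)) (a : Fin d) :
    partitionsContaining j (insert a A) =
      (partitionsContaining j A).filter fun b => b a = j := by
  ext b
  simp only [partitionsContaining, Finset.mem_filter, Finset.mem_insert, forall_eq_or_imp]
  tauto

theorem mul_card_fiber_compl_le {d n : ℕ} {j : Fin n} {A : Finset (Fin d)}
    {b : Fin d → Fin n} (hb : b ∈ partitionsContaining j A) :
    n * (Aᶜ.filter fun i => b i = j).card ≤ Aᶜ.card := by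
  have hb := Finset.mem_filter.1 hb
  have h1 := card_fiber_mul hb.1 j
  have h2 : (Finset.univ.filter fun i => b i = j).card =
      A.card + (Aᶜ.filter fun i => b i = j).card := by
    rw [← Finset.card_union_of_disjoint]
    · congr 1
      ext i
      simp only [Finset.mem_filter, Finset.mem_univ, true_and, Finset.mem_union,
        Finset.mem_compl]
      by_cases hi : i ∈ A
      · simp [hi, hb.2 i hi]
      · simp [hi]
    · exact Finset.disjoint_left.2 fun i hi h => (Finset.mem_compl.1 (Finset.mem_filter.1 h).1) hi
  have h3 : Aᶜ.card + A.card = d := by simp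
  have hn : 1 ≤ n := j.pos
  rw [h2] at h1
  nlinarith [Nat.zero_le A.card]

/-- Negative dependence, by double counting: all `a' ∉ A` are equally likely to join the block, and
a block of size `d/n` containing `A` has only `d/n - |A| ≤ (d - |A|)/n` places left for them. -/
theorem mul_card_partitionsContaining_insert_le {d n : ℕ} (j : Fin n) {A : Finset (Fin d)}
    {a : Fin d} (ha : a ∉ A) :
    n * (partitionsContaining j (insert a A)).card ≤ (partitionsContaining j A).card := by
  have hpos : 0 < Aᶜ.card := Finset.card_pos.2 ⟨a, Finset.mem_compl.2 ha⟩
  refine Nat.le_of_mul_le_mul_left ?_ hpos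
  calc Aᶜ.card * (n * (partitionsContaining j (insert a A)).card)
      = n * ∑ a' ∈ Aᶜ, (partitionsContaining j (insert a A)).card := by
        rw [Finset.sum_const, smul_eq_mul]; ring
    _ ≤ n * ∑ a' ∈ Aᶜ, (partitionsContaining j (insert a' A)).card :=
        Nat.mul_le_mul_left _ (Finset.sum_le_sum fun a' h =>
          card_partitionsContaining_insert_le j ha (Finset.mem_compl.1 h))
    _ = ∑ b ∈ partitionsContaining j A, n * (Aᶜ.filter fun i => b i = j).card := by
        rw [← Finset.mul_sum]
        congr 1
        simp only [partitionsContaining_insert, Finset.card_filter]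
        exact Finset.sum_comm
    _ ≤ ∑ b ∈ partitionsContaining j A, Aᶜ.card :=
        Finset.sum_le_sum fun b hb => mul_card_fiber_compl_le hb
    _ = Aᶜ.card * (partitionsContaining j A).card := by
        rw [Finset.sum_const, smul_eq_mul]; ring

theorem card_partitionsContaining_le {d n : ℕ} (j : Fin n) (A : Finset (Fin d)) :
    ((partitionsContaining j A).card : ℝ) ≤
      (equalPartitions d n).card * (1 / (n : ℝ)) ^ A.card := by
  induction A using Finset.induction_on with
  | empty => simp [partitionsContaining]
  | insert a A ha ih =>
    have hn : (0 : ℝ) < n := by exact_mod_cast j.pos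
    have h : (n : ℝ) * (partitionsContaining j (insert a A)).card ≤
        (partitionsContaining j A).card := by
      exact_mod_cast mul_card_partitionsContaining_insert_le j ha
    rw [Finset.card_insert_of_notMem ha, pow_succ, ← mul_assoc, mul_one_div, le_div_iff₀ hn]
    linarith

/-- The power of two counts the subsets of `A` inside block `j`. Each such subset contributes as if
coordinates were assigned independently, which sums to `(1 + 1/n)^|A|`. -/
theorem sum_two_pow_card_le {d n : ℕ} (j : Fin n) (A : Finset (Fin d)) :
    ∑ b ∈ equalPartitions d n, (2 : ℝ) ^ (A.filter fun i => b i = j).card ≤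
      (equalPartitions d n).card * Real.exp (A.card / n) := by
  have key : ∀ b : Fin d → Fin n, (2 : ℝ) ^ (A.filter fun i => b i = j).card =
      ∑ A' ∈ A.powerset, if ∀ i ∈ A', b i = j then (1 : ℝ) else 0 := by
    intro b
    rw [Finset.sum_boole]
    have : (A.powerset.filter fun A' => ∀ i ∈ A', b i = j) =
        (A.filter fun i => b i = j).powerset := by
      ext A'
      simp only [Finset.mem_filter, Finset.mem_powerset, Finset.subset_iff]
      exact ⟨fun h i hi => ⟨h.1 hi, h.2 i hi⟩, fun h => ⟨fun i hi => (h hi).1, fun i hi => (h hi).2⟩⟩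
    rw [this, Finset.card_powerset]
    norm_num
  calc ∑ b ∈ equalPartitions d n, (2 : ℝ) ^ (A.filter fun i => b i = j).card
      = ∑ A' ∈ A.powerset, ((partitionsContaining j A').card : ℝ) := by
        simp only [key]
        rw [Finset.sum_comm]
        refine Finset.sum_congr rfl fun A' _ => ?_
        rw [Finset.sum_boole]
        rfl
    _ ≤ ∑ A' ∈ A.powerset, (equalPartitions d n).card * (1 / (n : ℝ)) ^ A'.card :=
        Finset.sum_le_sum fun A' _ => card_partitionsContaining_le j A'
    _ = (equalPartitions d n).card * (1 / (n : ℝ) + 1) ^ A.card := by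
        rw [← Finset.mul_sum, ← Finset.sum_pow_mul_eq_add_pow]
        simp
    _ ≤ (equalPartitions d n).card * Real.exp (A.card / n) := by
        refine mul_le_mul_of_nonneg_left ?_ (Nat.cast_nonneg _)
        calc (1 / (n : ℝ) + 1) ^ A.card ≤ Real.exp (1 / n) ^ A.card :=
              pow_le_pow_left₀ (by positivity) (Real.add_one_le_exp _) _
          _ = Real.exp (A.card / n) := by
              rw [← Real.exp_nat_mul]; congr 1; ring

/-- The largest number of elements of `A` that fall into one block. -/
def maxLoad {d n : ℕ} (A : Finset (Fin d)) (b : Fin d → Fin n) : ℕ :=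
  Finset.univ.sup fun j => (A.filter fun i => b i = j).card

theorem card_filter_le_maxLoad {d n : ℕ} (A : Finset (Fin d)) (b : Fin d → Fin n) (j : Fin n) :
    (A.filter fun i => b i = j).card ≤ maxLoad A b :=
  Finset.le_sup (f := fun j => (A.filter fun i => b i = j).card) (Finset.mem_univ j)

theorem two_pow_maxLoad_le {d n : ℕ} (hn : 0 < n) (A : Finset (Fin d)) (b : Fin d → Fin n) :
    (2 : ℝ) ^ maxLoad A b ≤ ∑ j, (2 : ℝ) ^ (A.filter fun i => b i = j).card := by
  have : Nonempty (Fin n) := ⟨⟨0, hn⟩⟩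
  obtain ⟨j, -, hj⟩ := Finset.exists_mem_eq_sup Finset.univ Finset.univ_nonempty
    (fun j => (A.filter fun i => b i = j).card)
  rw [maxLoad, hj]
  exact Finset.single_le_sum (f := fun j => (2 : ℝ) ^ (A.filter fun i => b i = j).card)
    (fun _ _ => by positivity) (Finset.mem_univ j)

theorem expectation_maxLoad_le {d n : ℕ} (hn : 0 < n) (A : Finset (Fin d)) :
    expectation (fun b : Fin d → Fin n => (maxLoad A b : ℝ)) ≤
      (Real.log n + A.card / n) / Real.log 2 := by
  have hn' : (0 : ℝ) < n := by exact_mod_cast hn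
  have hl2 : 0 < Real.log 2 := Real.log_pos one_lt_two
  have hln : 0 ≤ Real.log n := Real.log_nonneg (by exact_mod_cast hn)
  set L : ℝ := Real.log n + A.card / n with hL
  have hL0 : 0 ≤ L := by positivity
  have hexpL : Real.exp L = n * Real.exp (A.card / n) := by
    rw [hL, Real.exp_add, Real.exp_log hn']
  -- Without any partition the expectation is `0 / 0 = 0`.
  rcases Nat.eq_zero_or_pos (equalPartitions d n).card with h0 | hpos
  · rw [expectation, h0]
    simpa using div_nonneg hL0 hl2.le
  have hN : (0 : ℝ) < (equalPartitions d n).card := by exact_mod_cast hpos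
  have hsum : ∑ b ∈ equalPartitions d n, (2 : ℝ) ^ maxLoad A b ≤
      (equalPartitions d n).card * Real.exp L := by
    calc ∑ b ∈ equalPartitions d n, (2 : ℝ) ^ maxLoad A b
        ≤ ∑ b ∈ equalPartitions d n, ∑ j, (2 : ℝ) ^ (A.filter fun i => b i = j).card :=
          Finset.sum_le_sum fun b _ => two_pow_maxLoad_le hn A b
      _ = ∑ j, ∑ b ∈ equalPartitions d n, (2 : ℝ) ^ (A.filter fun i => b i = j).card :=
          Finset.sum_comm
      _ ≤ ∑ _j : Fin n, (equalPartitions d n).card * Real.exp (A.card / n) :=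
          Finset.sum_le_sum fun j _ => sum_two_pow_card_le j A
      _ = (equalPartitions d n).card * Real.exp L := by
          rw [hexpL, Finset.sum_const, nsmul_eq_mul, Finset.card_univ, Fintype.card_fin]; ring
  -- Jensen's inequality for the logarithm, in tangent-line form at `exp L`.
  have hpt : ∀ k : ℕ, (k : ℝ) * Real.log 2 ≤ L - 1 + 2 ^ k / Real.exp L := by
    intro k
    have h := Real.add_one_le_exp (k * Real.log 2 - L)
    rw [Real.exp_sub, Real.exp_nat_mul, Real.exp_log two_pos] at h
    linarith
  have hsum2 : (∑ b ∈ equalPartitions d n, (maxLoad A b : ℝ)) * Real.log 2 ≤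
      (equalPartitions d n).card * L := by
    rw [Finset.sum_mul]
    calc ∑ b ∈ equalPartitions d n, (maxLoad A b : ℝ) * Real.log 2
        ≤ ∑ b ∈ equalPartitions d n, (L - 1 + 2 ^ maxLoad A b / Real.exp L) :=
          Finset.sum_le_sum fun b _ => hpt _
      _ = (equalPartitions d n).card * (L - 1) +
            (∑ b ∈ equalPartitions d n, (2 : ℝ) ^ maxLoad A b) / Real.exp L := by
          rw [Finset.sum_add_distrib, Finset.sum_const, nsmul_eq_mul, Finset.sum_div]
      _ ≤ (equalPartitions d n).card * (L - 1) + (equalPartitions d n).card := by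
          gcongr
          rwa [div_le_iff₀ (Real.exp_pos _)]
      _ = _ := by ring
  rw [expectation, div_le_div_iff₀ hN hl2]
  linarith

/-! ### Strong convexity of the mirror map in the block norm -/

/-- On `[0, m]` the second derivative `(p - 1) t^(p - 2)` of `t^p / p` is at least its value at `m`,
so subtracting the matching quadratic leaves a convex function, which lies above its tangents. -/
theorem rpow_bregman_ge {p m a b : ℝ} (hp : 1 < p) (hp2 : p ≤ 2) (ha : 0 ≤ a) (ham : a ≤ m)
    (hb : 0 ≤ b) (hbm : b ≤ m) :
    (p - 1) / 2 * m ^ (p - 2) * (a - b) ^ 2 ≤ a ^ p / p - b ^ p / p - b ^ (p - 1) * (a - b) := by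
  set c : ℝ := (p - 1) * m ^ (p - 2) with hc
  have hp0 : p ≠ 0 := by linarith
  let φ : ℝ → ℝ := fun t => t ^ p / p - c / 2 * t ^ 2
  have hφ' : ∀ t, HasDerivAt φ (t ^ (p - 1) - c * t) t := by
    intro t
    have h1 := (Real.hasDerivAt_rpow_const (x := t) (p := p) (Or.inr hp.le)).div_const p
    have h2 := (hasDerivAt_pow 2 t).const_mul (c / 2)
    refine (h1.sub h2).congr_deriv ?_
    field_simp
    ring
  have hφ'' : ∀ t, 0 < t →
      HasDerivAt (fun t : ℝ => t ^ (p - 1) - c * t) ((p - 1) * t ^ (p - 2) - c) t := by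
    intro t ht
    have h1 := Real.hasDerivAt_rpow_const (x := t) (p := p - 1) (Or.inl ht.ne')
    have h2 := (hasDerivAt_id t).const_mul c
    refine (h1.sub h2).congr_deriv ?_
    rw [mul_one, sub_sub, one_add_one_eq_two]
  have hconv : ConvexOn ℝ (Set.Icc 0 m) φ := by
    refine convexOn_of_hasDerivWithinAt2_nonneg (convex_Icc 0 m)
      (fun t _ => (hφ' t).continuousAt.continuousWithinAt)
      (fun t _ => (hφ' t).hasDerivWithinAt)
      (fun t ht => (hφ'' t (interior_Icc (α := ℝ) ▸ ht : t ∈ Set.Ioo 0 m).1).hasDerivWithinAt) ?_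
    intro t ht
    rw [interior_Icc] at ht
    have := Real.rpow_le_rpow_of_nonpos ht.1 ht.2.le (by linarith : p - 2 ≤ 0)
    have : (p - 1) * m ^ (p - 2) ≤ (p - 1) * t ^ (p - 2) :=
      mul_le_mul_of_nonneg_left this (by linarith)
    rw [hc]
    linarith
  have htangent : (b ^ (p - 1) - c * b) * (a - b) ≤ φ a - φ b := by
    rcases lt_trichotomy a b with h | h | h
    · have := hconv.slope_le_of_hasDerivAt ⟨ha, ham⟩ ⟨hb, hbm⟩ h (hφ' b)
      rw [slope_def_field, div_le_iff₀ (by linarith)] at this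
      linarith
    · simp [h]
    · have := hconv.le_slope_of_hasDerivAt ⟨hb, hbm⟩ ⟨ha, ham⟩ h (hφ' b)
      rwa [slope_def_field, le_div_iff₀ (by linarith)] at this
  simp only [φ] at htangent
  linarith [htangent, hc]

theorem norm_rpow_bregman_ge {E : Type*} [NormedAddCommGroup E] [InnerProductSpace ℝ E]
    {p : ℝ} (hp : 1 < p) (hp2 : p ≤ 2) (u v : E) :
    (p - 1) / 2 * max ‖u‖ ‖v‖ ^ (p - 2) * ‖u - v‖ ^ 2 ≤
      ‖u‖ ^ p / p - ‖v‖ ^ p / p - ‖v‖ ^ (p - 2) * inner ℝ v (u - v) := by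
  rcases eq_or_ne v 0 with rfl | hv
  · have h := rpow_bregman_ge hp hp2 (norm_nonneg u) le_rfl le_rfl (norm_nonneg u)
    have h1 : p - 1 ≠ 0 := by linarith
    simpa [Real.zero_rpow h1] using h
  have hv0 : 0 < ‖v‖ := norm_pos_iff.2 hv
  set m := max ‖u‖ ‖v‖ with hm
  have h := rpow_bregman_ge hp hp2 (norm_nonneg u) (le_max_left _ _ : ‖u‖ ≤ m)
    (norm_nonneg v) (le_max_right _ _)
  have h1 : ‖v‖ ^ (p - 1) = ‖v‖ ^ (p - 2) * ‖v‖ := by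
    rw [← Real.rpow_add_one hv0.ne']; ring_nf
  have h2 : m ^ (p - 2) ≤ ‖v‖ ^ (p - 2) :=
    Real.rpow_le_rpow_of_nonpos hv0 (le_max_right _ _) (by linarith)
  have h3 : 0 ≤ m ^ (p - 2) := Real.rpow_nonneg (hv0.le.trans (le_max_right _ _)) _
  have h4 : inner ℝ v u ≤ ‖v‖ * ‖u‖ := real_inner_le_norm v u
  -- Passing from norms to vectors adds `‖u‖‖v‖ - ⟪v, u⟫ ≥ 0` to both sides, with coefficient `(p -
  -- 1) m^(p - 2)` on the left and `‖v‖^(p - 2)` on the right.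
  have h5 : (p - 1) * m ^ (p - 2) ≤ ‖v‖ ^ (p - 2) := by nlinarith
  rw [inner_sub_right, real_inner_self_eq_norm_sq, norm_sub_sq_real, real_inner_comm]
  rw [h1] at h
  nlinarith [mul_nonneg (sub_nonneg.2 h5) (sub_nonneg.2 h4)]

/-- The coordinate projection onto the `j`-th block. -/
def blockProj {d n : ℕ} (b : Fin d → Fin n) (j : Fin n) : Vec d →L[ℝ] Vec d :=
  LinearMap.toContinuousLinearMap
    { toFun := fun x => WithLp.toLp 2 fun i => if b i = j then x i else 0
      map_add' := fun x y => by ext i; by_cases h : b i = j <;> simp [h]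
      map_smul' := fun c x => by ext i; by_cases h : b i = j <;> simp [h] }

theorem blockProj_apply {d n : ℕ} (b : Fin d → Fin n) (j : Fin n) (x : Vec d) (i : Fin d) :
    blockProj b j x i = if b i = j then x i else 0 := rfl

theorem blockEuclid_eq_norm {d n : ℕ} (b : Fin d → Fin n) (j : Fin n) (x : Vec d) :
    blockEuclid b x j = ‖blockProj b j x‖ := by
  rw [EuclideanSpace.norm_eq, blockEuclid, Finset.sum_filter]
  congr 1
  refine Finset.sum_congr rfl fun i _ => ?_
  rw [blockProj_apply]
  split_ifs <;> simp

theorem sum_inner_blockProj {d n : ℕ} (b : Fin d → Fin n) (x y : Vec d) :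
    ∑ j, inner ℝ (blockProj b j x) (blockProj b j y) = inner ℝ x y := by
  simp only [PiLp.inner_apply, blockProj_apply]
  rw [Finset.sum_comm]
  refine Finset.sum_congr rfl fun i _ => ?_
  rw [Finset.sum_eq_single (b i)]
  · simp
  · intro j _ hj
    simp [hj.symm]
  · simp

theorem one_lt_log_natCast {n : ℕ} (hn : 2 < n) : 1 < Real.log n := by
  rw [Real.lt_log_iff_exp_lt (by positivity)]
  have h : (3 : ℝ) ≤ n := by exact_mod_cast hn
  linarith [Real.exp_one_lt_d9]

theorem one_lt_pExp (n : ℕ) : 1 < pExp n := by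
  unfold pExp
  split_ifs with h
  · norm_num
  · have := one_lt_log_natCast (not_le.1 h)
    have : 0 < 1 / Real.log n := by positivity
    linarith

theorem pExp_le_two (n : ℕ) : pExp n ≤ 2 := by
  unfold pExp
  split_ifs with h
  · norm_num
  · have := one_lt_log_natCast (not_le.1 h)
    have : 1 / Real.log n ≤ 1 := by
      rw [div_le_one (by linarith)]; linarith
    linarith

theorem gammaCoeff_pos {n : ℕ} (hn : 0 < n) : 0 < gammaCoeff n := by
  unfold gammaCoeff
  split_ifs with h1 h2
  · norm_num
  · norm_num
  · have := one_lt_log_natCast (n := n) (by omega)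
    positivity

theorem hasFDerivAt_mirrorMap {d n : ℕ} (b : Fin d → Fin n) (x : Vec d) :
    HasFDerivAt (mirrorMap b) ((1 / (gammaCoeff n * pExp n)) • ∑ j : Fin n,
      ((pExp n * ‖blockProj b j x‖ ^ (pExp n - 2)) • innerSL ℝ (blockProj b j x)).comp
        (blockProj b j)) x := by
  have h : mirrorMap b = fun x : Vec d =>
      1 / (gammaCoeff n * pExp n) * ∑ j : Fin n, ‖blockProj b j x‖ ^ pExp n := by
    funext x
    simp only [mirrorMap, blockEuclid_eq_norm]
  rw [h]
  refine HasFDerivAt.const_mul (HasFDerivAt.fun_sum fun j _ => ?_) _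
  exact (hasFDerivAt_norm_rpow (blockProj b j x) (one_lt_pExp n)).comp x
    (blockProj b j).hasFDerivAt

theorem inner_gradient_eq_fderiv {d : ℕ} (h : Vec d → ℝ) (y v : Vec d) :
    inner ℝ (gradient h y) v = fderiv ℝ h y v :=
  InnerProductSpace.toDual_symm_apply

theorem bregman_mirrorMap {d n : ℕ} (b : Fin d → Fin n) (x y : Vec d) :
    bregman (mirrorMap b) x y = 1 / gammaCoeff n * ∑ j : Fin n,
      (‖blockProj b j x‖ ^ pExp n / pExp n - ‖blockProj b j y‖ ^ pExp n / pExp n -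
        ‖blockProj b j y‖ ^ (pExp n - 2) *
          inner ℝ (blockProj b j y) (blockProj b j x - blockProj b j y)) := by
  have hp : pExp n ≠ 0 := by linarith [one_lt_pExp n]
  rw [bregman, inner_gradient_eq_fderiv, (hasFDerivAt_mirrorMap b y).fderiv]
  simp only [mirrorMap, blockEuclid_eq_norm, Finset.sum_sub_distrib, _root_.smul_apply,
    _root_.sum_apply, ContinuousLinearMap.comp_apply, innerSL_apply_apply, smul_eq_mul,
    ← Finset.sum_div, mul_assoc, ← Finset.mul_sum, map_sub, inner_sub_right, mul_sub, one_div, mul_inv]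
  field_simp

/-- This fixes the choice of parameters: `n^(p - 1) = e` when `p - 1 = 1 / log n`, so weighted AM-GM
against the weight `1/n` bounds the sum by `2e`, and `γ_n` turns this into `2 / log n`. -/
theorem sum_rpow_le {n : ℕ} (hn : 0 < n) {m : Fin n → ℝ} (hm : ∀ j, 0 ≤ m j)
    (hsum : ∑ j, m j ≤ 2) :
    gammaCoeff n * ∑ j, m j ^ (2 - pExp n) ≤ 2 * (pExp n - 1) := by
  rcases Nat.lt_or_ge 2 n with h | h
  · have hl := one_lt_log_natCast h
    have hn0 : (0 : ℝ) < n := by positivity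
    have hγ : gammaCoeff n = 1 / (Real.exp 1 * Real.log n) := by
      rw [gammaCoeff, if_neg (by omega), if_neg (by omega)]
    have hp : pExp n - 1 = 1 / Real.log n := by
      rw [pExp, if_neg (by omega)]; ring
    have hp1 := one_lt_pExp n
    have hp2 := pExp_le_two n
    have he : (1 / (n : ℝ)) ^ (pExp n - 1) = 1 / Real.exp 1 := by
      rw [Real.div_rpow zero_le_one hn0.le, Real.one_rpow, hp, Real.rpow_def_of_pos hn0]
      congr 2
      field_simp
    have key : (∑ j, m j ^ (2 - pExp n)) * (1 / Real.exp 1) ≤ 2 := by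
      rw [← he, Finset.sum_mul]
      calc ∑ j, m j ^ (2 - pExp n) * (1 / (n : ℝ)) ^ (pExp n - 1)
          ≤ ∑ j, ((2 - pExp n) * m j + (pExp n - 1) * (1 / n)) :=
            Finset.sum_le_sum fun j _ => Real.geom_mean_le_arith_mean2_weighted
              (by linarith) (by linarith) (hm j) (by positivity) (by ring)
        _ = (2 - pExp n) * ∑ j, m j + (pExp n - 1) := by
            rw [Finset.sum_add_distrib, ← Finset.mul_sum, Finset.sum_const, nsmul_eq_mul,
              Finset.card_univ, Fintype.card_fin]
            field_simp
        _ ≤ 2 := by nlinarith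
    rw [hγ, hp]
    calc 1 / (Real.exp 1 * Real.log n) * ∑ j, m j ^ (2 - pExp n)
        = (∑ j, m j ^ (2 - pExp n)) * (1 / Real.exp 1) * (1 / Real.log n) := by
          field_simp
      _ ≤ 2 * (1 / Real.log n) := by gcongr
  · have hp : pExp n = 2 := by rw [pExp, if_pos h]
    rw [hp]
    interval_cases n <;> norm_num [gammaCoeff]

theorem blockNorm_sq_le_bregman {d n : ℕ} (hn : 0 < n) (b : Fin d → Fin n) {x y : Vec d}
    (hx : blockNorm b x ≤ 1) (hy : blockNorm b y ≤ 1) :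
    1 / 4 * blockNorm b (x - y) ^ 2 ≤ bregman (mirrorMap b) x y := by
  have hp1 := one_lt_pExp n
  have hp2 := pExp_le_two n
  have hγ : 0 < gammaCoeff n := gammaCoeff_pos hn
  simp only [blockNorm, blockEuclid_eq_norm, map_sub] at hx hy ⊢
  rw [bregman_mirrorMap]
  set p := pExp n
  set m : Fin n → ℝ := fun j => max ‖blockProj b j x‖ ‖blockProj b j y‖ with hm
  set w : Fin n → ℝ := fun j => m j ^ (p - 2) * ‖blockProj b j x - blockProj b j y‖ ^ 2 with hw
  have hm0 : ∀ j, 0 ≤ m j := fun j => (norm_nonneg _).trans (le_max_left _ _)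
  have hw0 : ∀ j, 0 ≤ w j := fun j => mul_nonneg (Real.rpow_nonneg (hm0 j) _) (sq_nonneg _)
  have hmsum : ∑ j, m j ≤ 2 := by
    calc ∑ j, m j ≤ ∑ j, (‖blockProj b j x‖ + ‖blockProj b j y‖) :=
          Finset.sum_le_sum fun j _ => max_le_add_of_nonneg (norm_nonneg _) (norm_nonneg _)
      _ ≤ 2 := by rw [Finset.sum_add_distrib]; linarith
  -- Cauchy-Schwarz with weights `m j ^ (p - 2)` and their inverses; where `m j = 0`, both blocks
  -- vanish.
  have hcs : (∑ j, ‖blockProj b j x - blockProj b j y‖) ^ 2 ≤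
      (∑ j, w j) * ∑ j, m j ^ (2 - p) := by
    refine Finset.sum_sq_le_sum_mul_sum_of_sq_le_mul _ (fun j _ => hw0 j)
      (fun j _ => Real.rpow_nonneg (hm0 j) _) fun j _ => ?_
    rcases (hm0 j).eq_or_lt with h | h
    · have hx0 : blockProj b j x = 0 := norm_le_zero_iff.1 (h ▸ le_max_left _ _)
      have hy0 : blockProj b j y = 0 := norm_le_zero_iff.1 (h ▸ le_max_right _ _)
      simp [hw, hx0, hy0]
    · have : m j ^ (p - 2) * m j ^ (2 - p) = 1 := by
        rw [← Real.rpow_add h]; simp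
      refine le_of_eq ?_
      simp only [hw]
      linear_combination -‖blockProj b j x - blockProj b j y‖ ^ 2 * this
  have hlow : (p - 1) / 2 * ∑ j, w j ≤ ∑ j : Fin n,
      (‖blockProj b j x‖ ^ p / p - ‖blockProj b j y‖ ^ p / p - ‖blockProj b j y‖ ^ (p - 2) *
          inner ℝ (blockProj b j y) (blockProj b j x - blockProj b j y)) := by
    rw [Finset.mul_sum]
    refine Finset.sum_le_sum fun j _ => ?_
    rw [hw, ← mul_assoc]
    exact norm_rpow_bregman_ge hp1 hp2 _ _
  have hM := sum_rpow_le hn hm0 hmsum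
  have hW : 0 ≤ ∑ j, w j := Finset.sum_nonneg fun j _ => hw0 j
  rw [one_div_mul_eq_div (gammaCoeff n), le_div_iff₀ hγ]
  refine le_trans ?_ hlow
  nlinarith [mul_le_mul_of_nonneg_left hcs hγ.le, mul_le_mul_of_nonneg_left hM hW]

/-! ### Mirror descent against linear losses -/

theorem hasFDerivAt_bregman {d : ℕ} {h : Vec d → ℝ} (hh : Differentiable ℝ h) (x y : Vec d) :
    HasFDerivAt (fun z => bregman h z y) (fderiv ℝ h x - innerSL ℝ (gradient h y)) x := by
  unfold bregman
  have h1 := ((hh x).hasFDerivAt.sub_const (h y)).sub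
    ((innerSL ℝ (gradient h y)).hasFDerivAt.comp x ((hasFDerivAt_id x).sub_const y))
  exact h1

theorem continuous_bregman {d : ℕ} {h : Vec d → ℝ} (hh : Differentiable ℝ h) (y : Vec d) :
    Continuous fun z => bregman h z y :=
  continuous_iff_continuousAt.2 fun x => (hasFDerivAt_bregman hh x y).continuousAt

theorem bregman_self {d : ℕ} (h : Vec d → ℝ) (x : Vec d) : bregman h x x = 0 := by
  simp [bregman]

/-- The three-point inequality for a mirror descent step. -/
theorem inner_sub_le_of_isMinOn {d : ℕ} {h : Vec d → ℝ} (hh : Differentiable ℝ h)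
    {K : Set (Vec d)} (hK : Convex ℝ K) {c : ℝ} {G y x z : Vec d}
    (hmin : IsMinOn (fun z => inner ℝ G z + c * bregman h z y) K x) (hx : x ∈ K) (hz : z ∈ K) :
    inner ℝ G (x - z) ≤ c * (bregman h z y - bregman h z x - bregman h x y) := by
  have hd : HasFDerivAt (fun z => inner ℝ G z + c * bregman h z y)
      (innerSL ℝ G + c • (fderiv ℝ h x - innerSL ℝ (gradient h y))) x :=
    (innerSL ℝ G).hasFDerivAt.add ((hasFDerivAt_bregman hh x y).const_mul c)
  have hpos := (IsMinOn.localize hmin).hasFDerivWithinAt_nonneg hd.hasFDerivWithinAt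
    (sub_mem_posTangentConeAt_of_segment_subset (hK.segment_subset hx hz))
  have hpos' : 0 ≤ inner ℝ G (z - x) +
      c * (inner ℝ (gradient h x) (z - x) - inner ℝ (gradient h y) (z - x)) := by
    rw [inner_gradient_eq_fderiv h x]
    exact hpos
  have h1 : inner ℝ G (x - z) = -inner ℝ G (z - x) := by rw [← inner_neg_right, neg_sub]
  have h2 : inner ℝ (gradient h y) (z - y) =
      inner ℝ (gradient h y) (z - x) + inner ℝ (gradient h y) (x - y) := by
    rw [← inner_add_right, sub_add_sub_cancel]
  rw [h1]
  simp only [bregman, h2]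
  linarith

/-- The regret bound of mirror descent against linear losses, when the step of round `t` costs at
most `M t`. -/
theorem sum_inner_sub_le {d : ℕ} {h : Vec d → ℝ} (hh : Differentiable ℝ h)
    {K : Set (Vec d)} (hK : Convex ℝ K) {c : ℝ} {G x : ℕ → Vec d} {M : ℕ → ℝ} {T : ℕ} (hT : 0 < T)
    (hx : ∀ t < T, x t ∈ K)
    (hmin : ∀ t, t + 1 < T →
      IsMinOn (fun z => inner ℝ (G t) z + c * bregman h z (x t)) K (x (t + 1)))
    (hM : ∀ t < T, ∀ u ∈ K, ∀ v ∈ K, inner ℝ (G t) (u - v) - c * bregman h v u ≤ M t)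
    {z : Vec d} (hz : z ∈ K) :
    ∑ t ∈ Finset.range T, inner ℝ (G t) (x t - z) ≤
      c * bregman h z (x 0) + ∑ t ∈ Finset.range T, M t := by
  have key : ∀ k < T, ∑ t ∈ Finset.range k, inner ℝ (G t) (x t - z) ≤
      c * (bregman h z (x 0) - bregman h z (x k)) + ∑ t ∈ Finset.range k, M t := by
    intro k
    induction k with
    | zero => simp
    | succ k ih =>
      intro hk
      have h1 := ih (by omega)
      have h2 := inner_sub_le_of_isMinOn hh hK (hmin k hk) (hx _ hk) hz
      have h3 := hM k (by omega) _ (hx k (by omega)) _ (hx _ hk)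
      have h4 : inner ℝ (G k) (x k - z) =
          inner ℝ (G k) (x k - x (k + 1)) + inner ℝ (G k) (x (k + 1) - z) := by
        rw [← inner_add_right, sub_add_sub_cancel]
      rw [Finset.sum_range_succ, Finset.sum_range_succ, h4]
      linarith
  obtain ⟨k, rfl⟩ : ∃ k, T = k + 1 := ⟨T - 1, by omega⟩
  -- No iterate follows the last round, so there the step bound is applied with the comparator `z`
  -- as the next point; it uses up the leftover `c * bregman h z (x k)`.
  have h1 := key k (by omega)
  have h2 := hM k (by omega) _ (hx k (by omega)) _ hz
  rw [Finset.sum_range_succ, Finset.sum_range_succ]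
  linarith

/-! ### Sparse losses are affine -/

theorem finite_setOf_zero_one (d : ℕ) : {v : Vec d | ∀ i, v i = 0 ∨ v i = 1}.Finite := by
  refine (Set.finite_range fun s : Fin d → Bool =>
    (WithLp.toLp 2 fun i => if s i then (1 : ℝ) else 0 : Vec d)).subset fun v hv => ?_
  refine ⟨fun i => decide (v i = 1), ?_⟩
  ext i
  rcases hv i with h | h <;> simp [h]

/-- A function with finitely many gradients on a convex set is affine there. -/
theorem sub_eq_inner_of_finite_gradients {d : ℕ} {K : Set (Vec d)} (hK : Convex ℝ K)
    {f : Vec d → ℝ} {g : Vec d → Vec d} (hg : ∀ x ∈ K, HasGradientWithinAt f (g x) K x)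
    (hfin : (g '' K).Finite) {x y : Vec d} (hx : x ∈ K) (hy : y ∈ K) :
    f y - f x = inner ℝ (g x) (y - x) := by
  let ℓ : ℝ → Vec d := AffineMap.lineMap x y
  have hℓ : ∀ s, HasDerivAt ℓ (y - x) s := fun s => AffineMap.hasDerivAt_lineMap
  have hmaps : Set.MapsTo ℓ (Set.Icc 0 1) K := fun s hs => hK.lineMap_mem hx hy hs
  let φ' : ℝ → ℝ := fun s => inner ℝ (g (ℓ s)) (y - x)
  have hφ : ∀ s ∈ Set.Icc (0 : ℝ) 1, HasDerivWithinAt (f ∘ ℓ) (φ' s) (Set.Icc 0 1) s := by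
    intro s hs
    exact (hg _ (hmaps hs)).hasFDerivWithinAt.comp_hasDerivWithinAt s
      (hℓ s).hasDerivWithinAt hmaps
  have hconst : ∀ s ∈ Set.Icc (0 : ℝ) 1, φ' s = φ' 0 := by
    have hconv := (convex_Icc (0 : ℝ) 1).image_hasDerivWithinAt hφ
    have hfin' : (φ' '' Set.Icc 0 1).Finite := by
      refine (hfin.image fun v => inner ℝ v (y - x)).subset ?_
      rintro _ ⟨s, hs, rfl⟩
      exact ⟨_, ⟨_, hmaps hs, rfl⟩, rfl⟩
    -- By Darboux the values of the derivative form an interval; being finite, it has at most one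
    -- point.
    have hsub : (φ' '' Set.Icc 0 1).Subsingleton := by
      intro a ha b hb
      by_contra hab
      rcases lt_or_gt_of_ne hab with h | h
      · exact (Set.Icc_infinite h) (hfin'.subset (hconv.ordConnected.out ha hb))
      · exact (Set.Icc_infinite h) (hfin'.subset (hconv.ordConnected.out hb ha))
    intro s hs
    exact hsub ⟨s, hs, rfl⟩ ⟨0, by simp, rfl⟩
  obtain ⟨s, hs, hslope⟩ := exists_hasDerivAt_eq_slope (f ∘ ℓ) φ' zero_lt_one
    (fun s hs => (hφ s hs).continuousWithinAt)
    (fun s hs => (hφ s (Set.Ioo_subset_Icc_self hs)).hasDerivAt (Icc_mem_nhds hs.1 hs.2))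
  rw [hconst s (Set.Ioo_subset_Icc_self hs)] at hslope
  simpa [φ', ℓ] using hslope.symm

theorem IsSparseLoss.sub_eq_inner {d S : ℕ} {K : Set (Vec d)} {f : Vec d → ℝ}
    {g : Vec d → Vec d} (hf : IsSparseLoss S K f g) {x y : Vec d} (hx : x ∈ K) (hy : y ∈ K) :
    f y - f x = inner ℝ (g x) (y - x) :=
  sub_eq_inner_of_finite_gradients hf.convexOn.1 hf.hasGradient
    ((finite_setOf_zero_one d).subset (by rintro _ ⟨z, hz, rfl⟩; exact hf.zero_one z hz)) hx hy

/-- The gradient within `K` need not be unique when `K` has empty interior. Changing the base point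
still shifts the linear functional on `K` only by a constant, which no minimizer over `K` can see.
-/
theorem IsSparseLoss.inner_eq_add {d S : ℕ} {K : Set (Vec d)} {f : Vec d → ℝ}
    {g : Vec d → Vec d} (hf : IsSparseLoss S K f g) {x y z : Vec d} (hx : x ∈ K) (hy : y ∈ K)
    (hz : z ∈ K) :
    inner ℝ (g x) z = inner ℝ (g y) z + (inner ℝ (g x) x - inner ℝ (g y) x) := by
  have h1 := hf.sub_eq_inner hx hz
  have h2 := hf.sub_eq_inner hy hz
  have h3 := hf.sub_eq_inner hy hx
  rw [inner_sub_right] at h1 h2 h3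
  linarith

/-! ### Dual norm of a sparse gradient and the cost of one step -/

/-- The coordinates on which `v` equals `1`. -/
def onesSet {d : ℕ} (v : Vec d) : Finset (Fin d) :=
  Finset.univ.filter fun i => v i = 1

theorem card_onesSet_le {d S : ℕ} {v : Vec d} (hv : ∀ i, v i = 0 ∨ v i = 1)
    (hS : ∑ i, |v i| ≤ (S : ℝ)) : ((onesSet v).card : ℝ) ≤ S := by
  refine le_trans (le_of_eq ?_) hS
  rw [onesSet, Finset.card_filter, Nat.cast_sum]
  refine Finset.sum_congr rfl fun i _ => ?_
  rcases hv i with h | h <;> simp [h]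

theorem norm_blockProj_sq_le {d n : ℕ} {v : Vec d} (hv : ∀ i, v i = 0 ∨ v i = 1)
    (b : Fin d → Fin n) (j : Fin n) : ‖blockProj b j v‖ ^ 2 ≤ maxLoad (onesSet v) b := by
  refine le_trans (le_of_eq ?_) (Nat.cast_le.2 (card_filter_le_maxLoad (onesSet v) b j))
  rw [EuclideanSpace.norm_sq_eq, onesSet, Finset.filter_filter, Finset.card_filter, Nat.cast_sum]
  refine Finset.sum_congr rfl fun i _ => ?_
  rw [blockProj_apply]
  rcases hv i with h | h <;> by_cases hb : b i = j <;> simp [h, hb]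

theorem inner_le_sqrt_maxLoad_mul {d n : ℕ} {v : Vec d} (hv : ∀ i, v i = 0 ∨ v i = 1)
    (b : Fin d → Fin n) (x : Vec d) :
    inner ℝ v x ≤ Real.sqrt (maxLoad (onesSet v) b) * blockNorm b x := by
  rw [← sum_inner_blockProj b, blockNorm, Finset.mul_sum]
  refine Finset.sum_le_sum fun j _ => (real_inner_le_norm _ _).trans ?_
  rw [blockEuclid_eq_norm]
  exact mul_le_mul_of_nonneg_right (Real.le_sqrt_of_sq_le (norm_blockProj_sq_le hv b j))
    (norm_nonneg _)

theorem blockNorm_sub_comm {d n : ℕ} (b : Fin d → Fin n) (x y : Vec d) :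
    blockNorm b (x - y) = blockNorm b (y - x) := by
  simp only [blockNorm, blockEuclid_eq_norm, map_sub, norm_sub_rev]

theorem inner_sub_bregman_le {d n : ℕ} (hn : 0 < n) (b : Fin d → Fin n) {η : ℝ} (hη : 0 < η)
    {v : Vec d} (hv : ∀ i, v i = 0 ∨ v i = 1) {x y : Vec d}
    (hx : blockNorm b x ≤ 1) (hy : blockNorm b y ≤ 1) :
    inner ℝ v (x - y) - 1 / η * bregman (mirrorMap b) y x ≤ η * maxLoad (onesSet v) b := by
  have h1 := inner_le_sqrt_maxLoad_mul hv b (x - y)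
  have h2 := blockNorm_sq_le_bregman hn b hy hx
  rw [blockNorm_sub_comm] at h2
  set r := Real.sqrt (maxLoad (onesSet v) b)
  have hr : r ^ 2 = maxLoad (onesSet v) b := Real.sq_sqrt (Nat.cast_nonneg _)
  set N := blockNorm b (x - y)
  have h3 := mul_le_mul_of_nonneg_left h2 (by positivity : 0 ≤ 1 / η)
  -- AM-GM, balanced so that the quadratic term is exactly the strong convexity bound.
  have h4 : r * N ≤ η * r ^ 2 + 1 / η * (1 / 4 * N ^ 2) := by
    have : η * r ^ 2 + 1 / η * (1 / 4 * N ^ 2) - r * N = 1 / η * (η * r - N / 2) ^ 2 := by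
      field_simp
      ring
    have : 0 ≤ 1 / η * (η * r - N / 2) ^ 2 := by positivity
    linarith
  rw [← hr]
  linarith

/-! ### Regret for a fixed partition -/

theorem differentiable_mirrorMap {d n : ℕ} (b : Fin d → Fin n) :
    Differentiable ℝ (mirrorMap b : Vec d → ℝ) :=
  fun x => (hasFDerivAt_mirrorMap b x).differentiableAt

theorem bregman_le_diamSq {d : ℕ} {h : Vec d → ℝ} (hh : Differentiable ℝ h) {K : Set (Vec d)}
    (hK : IsCompact K) {z : Vec d} (hz : z ∈ K) (y : Vec d) : bregman h z y ≤ diamSq h K y :=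
  le_csSup (hK.image (continuous_bregman hh y)).bddAbove ⟨z, hz, rfl⟩

theorem diamSq_nonneg {d : ℕ} {h : Vec d → ℝ} (hh : Differentiable ℝ h) {K : Set (Vec d)}
    (hK : IsCompact K) {x : Vec d} (hx : x ∈ K) : 0 ≤ diamSq h K x :=
  (bregman_self h x).symm.trans_le (bregman_le_diamSq hh hK hx x)

theorem eq_of_diamSq_eq_zero {d n : ℕ} (hn : 0 < n) {b : Fin d → Fin n} {K : Set (Vec d)}
    (hK : IsCompact K) (hKb : ∀ x ∈ K, blockNorm b x ≤ 1) {x z : Vec d} (hx : x ∈ K) (hz : z ∈ K)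
    (h0 : diamSq (mirrorMap b) K x = 0) : z = x := by
  have h1 := blockNorm_sq_le_bregman hn b (hKb z hz) (hKb x hx)
  have h2 := bregman_le_diamSq (differentiable_mirrorMap b) hK hz x
  have h3 : blockNorm b (z - x) = 0 := by
    refine pow_eq_zero_iff two_ne_zero |>.1 (le_antisymm (by linarith) (sq_nonneg _))
  have h4 : ∀ j, blockProj b j (z - x) = 0 := by
    simp only [blockNorm, blockEuclid_eq_norm] at h3
    intro j
    exact norm_eq_zero.1 ((Finset.sum_eq_zero_iff_of_nonneg fun _ _ => norm_nonneg _).1 h3 j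
      (Finset.mem_univ j))
  have h5 : inner ℝ (z - x) (z - x) = 0 := by
    rw [← sum_inner_blockProj b]
    simp only [h4, inner_zero_left, Finset.sum_const_zero]
  exact sub_eq_zero.1 (inner_self_eq_zero.1 h5)

theorem IsOMDRun.mem_of_lt {d T : ℕ} {h : Vec d → ℝ} {K : Set (Vec d)} {η : ℝ} {x₁ : Vec d}
    {g : ℕ → Vec d → Vec d} {x : ℕ → Vec d} (hx : IsOMDRun h K η x₁ T g x) (hx₁ : x₁ ∈ K) :
    ∀ t < T, x t ∈ K
  | 0, _ => hx.start ▸ hx₁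
  | t + 1, ht => hx.mem t ht

theorem regret_le {d T : ℕ} {K : Set (Vec d)} (hK : K.Nonempty) {f : ℕ → Vec d → ℝ}
    {x : ℕ → Vec d} {R : ℝ} (h : ∀ z ∈ K, ∑ t ∈ Finset.range T, (f t (x t) - f t z) ≤ R) :
    regret K T f x ≤ R := by
  rw [regret, sub_le_comm]
  refine le_csInf (hK.image _) ?_
  rintro _ ⟨z, hz, rfl⟩
  have := h z hz
  rw [Finset.sum_sub_distrib] at this
  show _ ≤ ∑ t ∈ Finset.range T, f t z
  linarith

theorem regret_le_of_isOMDRun {d n S T : ℕ} (hn : 0 < n) (hT : 0 < T) {b : Fin d → Fin n}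
    {K : Set (Vec d)} (hK : IsCompact K) (hKc : Convex ℝ K) (hKb : ∀ x ∈ K, blockNorm b x ≤ 1)
    {x₁ : Vec d} (hx₁ : x₁ ∈ K) {η : ℝ} (hη : 0 < η) {f : ℕ → Vec d → ℝ}
    {g : ℕ → Vec d → Vec d} (hf : ∀ t < T, IsSparseLoss S K (f t) (g t)) {x : ℕ → Vec d}
    (hx : IsOMDRun (mirrorMap b) K η x₁ T g x) :
    regret K T f x ≤ 1 / η * diamSq (mirrorMap b) K x₁ +
      ∑ t ∈ Finset.range T, η * maxLoad (onesSet (g t x₁)) b := by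
  have hmem := hx.mem_of_lt hx₁
  refine regret_le ⟨x₁, hx₁⟩ fun z hz => ?_
  have h1 : ∑ t ∈ Finset.range T, (f t (x t) - f t z) =
      ∑ t ∈ Finset.range T, inner ℝ (g t x₁) (x t - z) := by
    refine Finset.sum_congr rfl fun t ht => ?_
    have ht := Finset.mem_range.1 ht
    have h2 := (hf t ht).sub_eq_inner hx₁ (hmem t ht)
    have h3 := (hf t ht).sub_eq_inner hx₁ hz
    rw [inner_sub_right] at h2 h3 ⊢
    linarith
  rw [h1]
  refine (sum_inner_sub_le (c := 1 / η) (differentiable_mirrorMap b) hKc hT hmem ?_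
    (fun t ht u hu v hv => inner_sub_bregman_le hn b hη ((hf t ht).zero_one x₁ hx₁)
      (hKb u hu) (hKb v hv)) hz).trans ?_
  -- The iterates also minimize the objectives built from the gradients at `x₁`, which do not depend
  -- on the partition.
  · refine fun t ht => isMinOn_iff.2 fun z hz => ?_
    have h2 := isMinOn_iff.1 (hx.argmin t ht) z hz
    have h3 := (hf t (by omega)).inner_eq_add (hmem t (by omega)) hx₁ hz
    have h4 := (hf t (by omega)).inner_eq_add (hmem t (by omega)) hx₁ (hmem (t + 1) ht)
    linarith
  · rw [hx.start]
    gcongr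
    exact bregman_le_diamSq (differentiable_mirrorMap b) hK hz x₁

/-! ### Averaging over the partition and choosing the step size -/

theorem expectation_le_expectation {d n : ℕ} {X Y : (Fin d → Fin n) → ℝ}
    (h : ∀ b ∈ equalPartitions d n, X b ≤ Y b) : expectation X ≤ expectation Y :=
  div_le_div_of_nonneg_right (Finset.sum_le_sum h) (Nat.cast_nonneg _)

theorem expectation_add {d n : ℕ} (X Y : (Fin d → Fin n) → ℝ) :
    expectation (fun b => X b + Y b) = expectation X + expectation Y := by
  simp only [expectation, Finset.sum_add_distrib, add_div]

theorem expectation_const_mul {d n : ℕ} (c : ℝ) (X : (Fin d → Fin n) → ℝ) :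
    expectation (fun b => c * X b) = c * expectation X := by
  simp only [expectation, ← Finset.mul_sum, mul_div_assoc]

theorem expectation_finset_sum {d n : ℕ} {ι : Type*} (s : Finset ι)
    (X : ι → (Fin d → Fin n) → ℝ) :
    expectation (fun b => ∑ t ∈ s, X t b) = ∑ t ∈ s, expectation (X t) := by
  simp only [expectation, ← Finset.sum_div]
  rw [Finset.sum_comm]

theorem expectation_nonneg {d n : ℕ} {X : (Fin d → Fin n) → ℝ}
    (h : ∀ b ∈ equalPartitions d n, 0 ≤ X b) : 0 ≤ expectation X :=
  div_nonneg (Finset.sum_nonneg h) (Nat.cast_nonneg _)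

theorem eq_zero_of_expectation_eq_zero {d n : ℕ} {X : (Fin d → Fin n) → ℝ}
    (h : ∀ b ∈ equalPartitions d n, 0 ≤ X b) (h0 : expectation X = 0) :
    ∀ b ∈ equalPartitions d n, X b = 0 := by
  intro b hb
  have hc : ((equalPartitions d n).card : ℝ) ≠ 0 :=
    Nat.cast_ne_zero.2 (Finset.card_pos.2 ⟨b, hb⟩).ne'
  exact (Finset.sum_eq_zero_iff_of_nonneg h).1 ((div_eq_zero_iff.1 h0).resolve_right hc) b hb

/-- A constant step size gives expected regret of order `D √(T L)`, where `L` bounds the expected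
load of the fullest block. -/
theorem exists_step_expectation_regret_le {d n S T : ℕ} (hn : 0 < n) (hS : 1 ≤ S)
    {K : Set (Vec d)} (hK : IsCompact K) (hKc : Convex ℝ K)
    (hKb : ∀ b ∈ equalPartitions d n, ∀ x ∈ K, blockNorm b x ≤ 1) {x₁ : Vec d} (hx₁ : x₁ ∈ K) :
    ∃ η : ℝ, 0 < η ∧ ∀ (f : ℕ → Vec d → ℝ) (g : ℕ → Vec d → Vec d),
      (∀ t < T, IsSparseLoss S K (f t) (g t)) → ∀ x : (Fin d → Fin n) → ℕ → Vec d,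
      (∀ b ∈ equalPartitions d n, IsOMDRun (mirrorMap b) K η x₁ T g (x b)) →
      expectation (fun b : Fin d → Fin n => regret K T f (x b)) ≤
        2 * (Real.sqrt ((Real.log n + S / n) / Real.log 2) *
          Real.sqrt (expectation fun b : Fin d → Fin n => diamSq (mirrorMap b) K x₁) *
            Real.sqrt T) := by
  have hl2 : 0 < Real.log 2 := Real.log_pos one_lt_two
  have hln : 0 ≤ Real.log n := Real.log_nonneg (by exact_mod_cast hn)
  have hn' : (0 : ℝ) < n := by exact_mod_cast hn
  have hS' : (0 : ℝ) < S := by exact_mod_cast hS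
  set L : ℝ := (Real.log n + S / n) / Real.log 2 with hL
  have hL0 : 0 < L := by positivity
  have hnonneg : ∀ b ∈ equalPartitions d n, 0 ≤ diamSq (mirrorMap b) K x₁ :=
    fun b _ => diamSq_nonneg (differentiable_mirrorMap b) hK hx₁
  set V : ℝ := expectation fun b : Fin d → Fin n => diamSq (mirrorMap b) K x₁ with hV
  have hV0 : 0 ≤ V := expectation_nonneg hnonneg
  -- Here the balanced step size would not be a positive number. If `V = 0`, then `K` is a single
  -- point as soon as a partition exists, so any step size works.
  by_cases htriv : T = 0 ∨ V = 0
  · refine ⟨1, one_pos, fun f g _ x hx => ?_⟩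
    have h0 : ∀ b ∈ equalPartitions d n, regret K T f (x b) ≤ 0 := by
      intro b hb
      refine regret_le ⟨x₁, hx₁⟩ fun z hz => ?_
      rcases htriv with rfl | h
      · simp
      · have hd := eq_zero_of_expectation_eq_zero hnonneg h b hb
        have huniq : ∀ z ∈ K, z = x₁ := fun z hz =>
          eq_of_diamSq_eq_zero hn hK (hKb b hb) hx₁ hz hd
        refine (Finset.sum_eq_zero fun t ht => ?_).le
        rw [huniq z hz, huniq _ ((hx b hb).mem_of_lt hx₁ t (Finset.mem_range.1 ht)), sub_self]
    refine (expectation_le_expectation h0).trans ?_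
    simp only [expectation, Finset.sum_const_zero, zero_div]
    positivity
  · push Not at htriv
    have hT : 0 < T := Nat.pos_of_ne_zero htriv.1
    have hT' : (0 : ℝ) < T := by exact_mod_cast hT
    have hVpos : 0 < V := lt_of_le_of_ne hV0 htriv.2.symm
    set r := Real.sqrt V
    set s := Real.sqrt L
    set q := Real.sqrt (T : ℝ)
    have hr : 0 < r := Real.sqrt_pos.2 hVpos
    have hs : 0 < s := Real.sqrt_pos.2 hL0
    have hq : 0 < q := Real.sqrt_pos.2 hT'
    have hr2 : r ^ 2 = V := Real.sq_sqrt hV0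
    have hs2 : s ^ 2 = L := Real.sq_sqrt hL0.le
    have hq2 : q ^ 2 = T := Real.sq_sqrt hT'.le
    have hη : 0 < r / (s * q) := by positivity
    -- The minimizer of `V / η + η L T`.
    refine ⟨r / (s * q), hη, fun f g hf x hx => ?_⟩
    set η := r / (s * q) with hη_def
    have hload : ∀ t ∈ Finset.range T,
        expectation (fun b : Fin d → Fin n => η * (maxLoad (onesSet (g t x₁)) b : ℝ)) ≤ η * L := by
      intro t ht
      have hft := hf t (Finset.mem_range.1 ht)
      rw [expectation_const_mul]
      refine mul_le_mul_of_nonneg_left ((expectation_maxLoad_le hn _).trans ?_) hη.le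
      rw [hL]
      gcongr
      exact_mod_cast card_onesSet_le (hft.zero_one x₁ hx₁) (hft.sparse x₁ hx₁)
    calc expectation (fun b : Fin d → Fin n => regret K T f (x b))
        ≤ expectation (fun b : Fin d → Fin n => 1 / η * diamSq (mirrorMap b) K x₁ +
            ∑ t ∈ Finset.range T, η * (maxLoad (onesSet (g t x₁)) b : ℝ)) :=
          expectation_le_expectation fun b hb =>
            regret_le_of_isOMDRun hn hT hK hKc (hKb b hb) hx₁ hη hf (hx b hb)
      _ ≤ 1 / η * V + ∑ t ∈ Finset.range T, η * L := by
          rw [expectation_add, expectation_const_mul, expectation_finset_sum]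
          gcongr with t ht
          exact hload t ht
      _ = 1 / η * r ^ 2 + q ^ 2 * (η * s ^ 2) := by
          rw [Finset.sum_const, nsmul_eq_mul, Finset.card_range, hr2, hq2, hs2]
      _ = 2 * (s * r * q) := by
          rw [hη_def]
          field_simp
          ring

/-! ### The two regimes of the load bound -/

theorem log_add_div_le_of_le {n S : ℕ} (hn : 0 < n) (hS : 1 ≤ S)
    (h : (n : ℝ) ≤ S / Real.log S ∨ n = 1) :
    (Real.log n + S / n) / Real.log 2 ≤ 10 * ((S : ℝ) / n) := by
  have hl2 : 1 / 2 < Real.log 2 := by linarith [Real.log_two_gt_d9]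
  have hn' : (0 : ℝ) < n := by exact_mod_cast hn
  have hS' : (0 : ℝ) < S := by exact_mod_cast hS
  have hSn : 0 < (S : ℝ) / n := by positivity
  have hlog : Real.log n ≤ 2 * (S / n) := by
    rcases h with h | rfl
    · rcases hS.eq_or_lt with rfl | hS2
      -- For `S = 1` the quotient `S / log S` is `1 / 0 = 0`, so this case cannot occur.
      · simp only [Nat.cast_one, Real.log_one, div_zero] at h
        linarith
      · have hlS : Real.log 2 ≤ Real.log S :=
          Real.log_le_log two_pos (by exact_mod_cast hS2)
        have hlS0 : 0 < Real.log S := by linarith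
        have h1 : (n : ℝ) * Real.log S ≤ S := (le_div_iff₀ hlS0).1 h
        -- Since `n ≤ 2 S`, this yields `log n ≤ 2 log S ≤ 2 S / n`.
        have h2 : Real.log S ≤ S / n := by rw [le_div_iff₀ hn']; linarith
        have h3 : (n : ℝ) ≤ 2 * S := by nlinarith
        have h4 : Real.log n ≤ Real.log 2 + Real.log S := by
          rw [← Real.log_mul two_ne_zero hS'.ne']
          exact Real.log_le_log hn' h3
        linarith
    · simp only [Nat.cast_one, Real.log_one]
      positivity
  rw [div_le_iff₀ (by linarith)]
  nlinarith

theorem log_add_div_le_of_lt {n S : ℕ} (hn : 0 < n) (hS : 1 ≤ S)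
    (h : (S : ℝ) / Real.log S < n) (hn1 : n ≠ 1) :
    (Real.log n + S / n) / Real.log 2 ≤ 10 * Real.log n := by
  have hl2 : 1 / 2 < Real.log 2 := by linarith [Real.log_two_gt_d9]
  have hn' : (0 : ℝ) < n := by exact_mod_cast hn
  have hS' : (0 : ℝ) < S := by exact_mod_cast hS
  have hn2 : (2 : ℝ) ≤ n := by exact_mod_cast (by omega : 2 ≤ n)
  have hln : Real.log 2 ≤ Real.log n := Real.log_le_log two_pos hn2
  have hdiv : (S : ℝ) / n ≤ 4 * Real.log n := by
    rcases hS.eq_or_lt with rfl | hS2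
    · have : ((1 : ℕ) : ℝ) / n ≤ 1 / 2 := by
        rw [Nat.cast_one]
        exact one_div_le_one_div_of_le two_pos hn2
      linarith
    · have hlS0 : 0 < Real.log S := Real.log_pos (by exact_mod_cast hS2)
      have h1 : (S : ℝ) < n * Real.log S := (div_lt_iff₀ hlS0).1 h
      -- The bound `log S ≤ 2 √S` turns `S < n log S` into `√S < 2 n`, hence `log S ≤ 4 log n`.
      set q := Real.sqrt (S : ℝ)
      have hq : 0 < q := Real.sqrt_pos.2 hS'
      have hq2 : q ^ 2 = S := Real.sq_sqrt hS'.le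
      have h2 : Real.log S = 2 * Real.log q := by
        rw [← hq2, Real.log_pow]; norm_num
      have h3 : Real.log q ≤ q := by linarith [Real.log_le_sub_one_of_pos hq]
      have h4 : q < 2 * n := by
        rw [h2, ← hq2] at h1
        nlinarith
      have h5 : Real.log q ≤ Real.log 2 + Real.log n := by
        rw [← Real.log_mul two_ne_zero hn'.ne']
        exact Real.log_le_log hq h4.le
      rw [div_le_iff₀ hn']
      nlinarith
  rw [div_le_iff₀ (by linarith)]
  nlinarith

end BlockOMD

end

theorem theorem1 :
    ∃ C : ℝ, 0 < C ∧
      ∀ (d n S T : ℕ), 0 < n → n ∣ d → 1 ≤ S →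
      ∀ (K : Set (BlockOMD.Vec d)), IsCompact K → Convex ℝ K →
      (∀ b ∈ BlockOMD.equalPartitions d n, ∀ x ∈ K, BlockOMD.blockNorm b x ≤ 1) →
      ∀ x₁ ∈ K,
      ∃ η : ℝ, 0 < η ∧
        ∀ (f : ℕ → BlockOMD.Vec d → ℝ) (g : ℕ → BlockOMD.Vec d → BlockOMD.Vec d),
        (∀ t < T, BlockOMD.IsSparseLoss S K (f t) (g t)) →
        ∀ (x : (Fin d → Fin n) → ℕ → BlockOMD.Vec d),
        (∀ b ∈ BlockOMD.equalPartitions d n,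
          BlockOMD.IsOMDRun (BlockOMD.mirrorMap b) K η x₁ T g (x b)) →
        ((n : ℝ) ≤ (S : ℝ) / Real.log S ∨ n = 1 →
          BlockOMD.expectation (fun b : Fin d → Fin n => BlockOMD.regret K T f (x b)) ≤
            C * (Real.sqrt ((S : ℝ) / n) *
              Real.sqrt (BlockOMD.expectation fun b : Fin d → Fin n =>
                BlockOMD.diamSq (BlockOMD.mirrorMap b) K x₁) * Real.sqrt T)) ∧
        ((S : ℝ) / Real.log S < (n : ℝ) ∧ n ≠ 1 →
          BlockOMD.expectation (fun b : Fin d → Fin n => BlockOMD.regret K T f (x b)) ≤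
            C * (Real.sqrt (Real.log n) *
              Real.sqrt (BlockOMD.expectation fun b : Fin d → Fin n =>
                BlockOMD.diamSq (BlockOMD.mirrorMap b) K x₁) * Real.sqrt T)) := by
  -- The `2` comes from balancing the step size, the `10` from the two regime bounds on `L`.
  refine ⟨2 * Real.sqrt 10, by positivity, ?_⟩
  intro d n S T hn _ hS K hK hKc hKb x₁ hx₁
  obtain ⟨η, hη, hreg⟩ :=
    BlockOMD.exists_step_expectation_regret_le (T := T) hn hS hK hKc hKb hx₁
  refine ⟨η, hη, fun f g hf x hx => ⟨fun h => ?_, fun h => ?_⟩⟩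
  · refine (hreg f g hf x hx).trans ?_
    rw [mul_assoc 2, ← mul_assoc (Real.sqrt 10), ← mul_assoc (Real.sqrt 10),
      ← Real.sqrt_mul (by norm_num : (0 : ℝ) ≤ 10)]
    gcongr
    exact BlockOMD.log_add_div_le_of_le hn hS h
  · refine (hreg f g hf x hx).trans ?_
    rw [mul_assoc 2, ← mul_assoc (Real.sqrt 10), ← mul_assoc (Real.sqrt 10),
      ← Real.sqrt_mul (by norm_num : (0 : ℝ) ≤ 10)]
    gcongr
    exact BlockOMD.log_add_div_le_of_lt hn hS h.1 h.2
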